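/- Let $n,K\ge 1$ be integers, let $z:\{1,\dots,n\}\to\{1,\dots,K\}$ be a (deterministic) assignment of $n$ nodes to $K$ communities, let $\Theta\in\{0,1\}^{n\times K}$ be its membership matrix ($\Theta_{ik}=1$ if and only if $z(i)=k$), and let $n_k$ be the size of the $k$-th community. Let $n_{\min}\ge 1$ and $n_{\max}$ be integers with $n_{\min}\le n_k\le n_{\max}$ for all $k$. Let $\tau\in[0,1]$, $\alpha_n\in(0,1)$, $B_0=(1-\tau)I_K+\tau 1_K1_K^\top$ (with entries $b^{(0)}_{k\ell}$), $B=\alpha_nB_0$ and $P=\Theta B\Theta^\top$. Let $A\in\{0,1\}^{n\times n}$ be the adjacency matrix of the static stochastic block model: the $A_{ij}$, $i<j$, are independent, $A_{ij}\sim\mathrm{Ber}(P_{ij})$, $A_{ji}=A_{ij}$ and $A_{ii}=0$. Let $N$ be the set of all integer vectors $(m_1,\dots,m_K)$ with $n_{\min}\le m_k\le n_{\max}$ for all $k$ and $\sum_k m_k=n$, and put $$\bar n_{\max}=\max_{m\in N,\,k\le K}\ \sum_\ell m_\ell b^{(0)}_{k\ell},\qquad \bar n_{\min}=\min_{m\in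 N,\,k\le K}\ \sum_\ell m_\ell b^{(0)}_{k\ell}.$$ Then for every $c>0$ and every $\nu>0$ there is a constant $C_\nu>0$, depending only on $c$ and $\nu$, such that, for all models as above with $$\alpha_n\ \ge\ c\,\frac{\log n}{\bar n_{\min}},$$ one has, with probability at least $1-\sum_{k=1}^K n_k^{-\nu}$, $$\|A-P\|\ \le\ C_\nu\sqrt{\bar n_{\max}\,\alpha_n},$$ where $\|\cdot\|$ is the spectral norm. -/

import Mathlib

open MeasureTheory ProbabilityTheory

namespace StochasticBlock

noncomputable section

/-- The `0-1` membership matrix `Θ` (`n × K`) of the assignment `z` of nodes to communities. -/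
def membership {n K : ℕ} (z : Fin n → Fin K) : Matrix (Fin n) (Fin K) ℝ :=
  Matrix.of fun i k => if z i = k then 1 else 0

/-- The size `n_k` of the community `k`. -/
def commSize {n K : ℕ} (z : Fin n → Fin K) (k : Fin K) : ℕ :=
  (Finset.univ.filter fun i => z i = k).card

/-- The matrix `P = Θ B Θᵀ` of connection probabilities. -/
def probMatrix {n K : ℕ} (z : Fin n → Fin K) (B : Matrix (Fin K) (Fin K) ℝ) :
    Matrix (Fin n) (Fin n) ℝ :=
  membership z * B * (membership z).transpose

/-- The matrix `B₀ = (1 - τ) I + τ 1 1ᵀ`. -/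
def baseConn (K : ℕ) (τ : ℝ) : Matrix (Fin K) (Fin K) ℝ :=
  (1 - τ) • (1 : Matrix (Fin K) (Fin K) ℝ) + τ • Matrix.vecMulVec (fun _ => 1) (fun _ => 1)

/-- The set `N` of admissible community sizes. -/
def admissibleSizes (n K nmin nmax : ℕ) : Set (Fin K → ℕ) :=
  {m | (∀ k, nmin ≤ m k ∧ m k ≤ nmax) ∧ ∑ k, m k = n}

/-- The values `∑ ℓ, m_ℓ b_{kℓ}`, for `m` in `N` and `k` a community. -/
def weightedSizes (n nmin nmax : ℕ) {K : ℕ} (B₀ : Matrix (Fin K) (Fin K) ℝ) : Set ℝ :=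
  {x | ∃ m ∈ admissibleSizes n K nmin nmax, ∃ k, x = ∑ l, (m l : ℝ) * B₀ k l}

/-- `n̄_max`, the largest of the weighted sizes (a finite set). -/
def nBarMax (n nmin nmax : ℕ) {K : ℕ} (B₀ : Matrix (Fin K) (Fin K) ℝ) : ℝ :=
  sSup (weightedSizes n nmin nmax B₀)

/-- `n̄_min`, the smallest of the weighted sizes (a finite set). -/
def nBarMin (n nmin nmax : ℕ) {K : ℕ} (B₀ : Matrix (Fin K) (Fin K) ℝ) : ℝ :=
  sInf (weightedSizes n nmin nmax B₀)

theorem weightedSizes_finite (n nmin nmax : ℕ) {K : ℕ} (B₀ : Matrix (Fin K) (Fin K) ℝ) :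
    (weightedSizes n nmin nmax B₀).Finite := by
  have h1 : (admissibleSizes n K nmin nmax).Finite :=
    (Set.finite_Icc (fun _ : Fin K => nmin) (fun _ => nmax)).subset
      fun m hm => ⟨fun k => (hm.1 k).1, fun k => (hm.1 k).2⟩
  refine ((h1.prod (Set.finite_univ (α := Fin K))).image
    fun q => ∑ l, (q.1 l : ℝ) * B₀ q.2 l).subset ?_
  rintro x ⟨m, hm, k, rfl⟩
  exact ⟨(m, k), ⟨hm, Set.mem_univ k⟩, rfl⟩

/-- `A` is the random adjacency matrix of a static stochastic block model with memberships `z`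
and connectivity matrix `B`: a symmetric `0-1` matrix with zero diagonal, whose entries above the
diagonal are independent, `A i j` being Bernoulli with parameter `B (z i) (z j)`. -/
structure IsSBM {Ω : Type*} [MeasurableSpace Ω] (μ : Measure Ω) {n K : ℕ}
    (z : Fin n → Fin K) (B : Matrix (Fin K) (Fin K) ℝ)
    (A : Ω → Matrix (Fin n) (Fin n) ℝ) : Prop where
  measurable_entry : ∀ i j, Measurable fun ω => A ω i j
  zero_or_one : ∀ ω i j, A ω i j = 0 ∨ A ω i j = 1
  diag_zero : ∀ ω i, A ω i i = 0
  symmetric : ∀ ω i j, A ω j i = A ω i j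
  prob_one : ∀ i j, i < j → μ {ω | A ω i j = 1} = ENNReal.ofReal (B (z i) (z j))
  indep : iIndepFun (fun (e : {e : Fin n × Fin n // e.1 < e.2}) ω => A ω e.1.1 e.1.2) μ

/-- The spectral norm: the operator norm of `M` acting on Euclidean space. -/
def specNorm {n : ℕ} (M : Matrix (Fin n) (Fin n) ℝ) : ℝ :=
  ‖Matrix.toEuclideanCLM (n := Fin n) (𝕜 := ℝ) M‖

end

end StochasticBlock

/-! The proof is the trace method. Let `d` be `nBarMax * α`, an upper bound for the row sums of `P`.
For the centred matrix with its diagonal removed, the expected trace of the power `2 * q` is a sum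
over closed walks. By independence and centring, only walks using no edge exactly once survive, and
since entries have modulus at most 1, each edge used costs one factor `p e`, a bound for its
variance.

The walks are not enumerated. They are grouped by pattern, that is, by the kernel of the walk. A
pattern with `r` distinct vertices has total weight at most `n * D ^ (r - 1)` if the row sums are at
most `D`, and `r ≤ q + 1`. A complete graph on `2 * q ≥ D + q` vertices carries at least `D ^ r`
walks of that pattern. So the moment is at most `n` times the number of good walks there
(`sum_goodWalk_prod_edgeSet_le`). That number is at most the moment of an auxiliary subgaussian
matrix of size `2 * q` (`card_goodWalk_le_sum_trace`), which a net argument bounds by `(const * q) ^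
q` up to exponential factors.

Markov's inequality then gives norm at most `const * √q` outside an event of probability `n * exp
(-q)`. Choosing `q` above both `d` and `(ν + 1) * log n` makes this at most `n ^ (-ν)`, while the
lower bound on `α` keeps `q` of order `d`. -/

namespace StochasticBlock

/-! ### Walks, their patterns and traces of powers -/

section Walks

open Finset Function

variable {V U : Type*} {L : ℕ}

/-- The `i`-th edge of a walk. -/
def stepEdge (w : Fin (L + 1) → V) (i : Fin L) : Sym2 V := s(w i.castSucc, w i.succ)

/-- The set of edges of a walk. -/
def edgeSet [DecidableEq V] (w : Fin (L + 1) → V) : Finset (Sym2 V) := univ.image (stepEdge w)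

/-- The number of times that a walk uses an edge. -/
def edgeMult [DecidableEq V] (w : Fin (L + 1) → V) (e : Sym2 V) : ℕ :=
  (univ.filter fun i => stepEdge w i = e).card

/-- Closed walks without loops that use no edge exactly once. -/
def GoodWalk [DecidableEq V] (w : Fin (L + 1) → V) : Prop :=
  w 0 = w (Fin.last L) ∧ (∀ i : Fin L, w i.castSucc ≠ w i.succ) ∧ ∀ e, edgeMult w e ≠ 1

theorem stepEdge_cons_zero (a : V) (w : Fin (L + 1) → V) :
    stepEdge (Fin.cons a w : Fin (L + 1 + 1) → V) 0 = s(a, w 0) := by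
  simp only [stepEdge, Fin.castSucc_zero, Fin.cons_zero, Fin.cons_succ]

theorem stepEdge_cons_succ (a : V) (w : Fin (L + 1) → V) (i : Fin L) :
    stepEdge (Fin.cons a w : Fin (L + 1 + 1) → V) i.succ = stepEdge w i := by
  simp only [stepEdge, ← Fin.succ_castSucc, Fin.cons_succ]

theorem edgeSet_cons [DecidableEq V] (a : V) (w : Fin (L + 1) → V) :
    edgeSet (Fin.cons a w : Fin (L + 1 + 1) → V) = insert s(a, w 0) (edgeSet w) := by
  ext e
  simp only [edgeSet, mem_image, mem_univ, true_and, mem_insert, Fin.exists_fin_succ,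
    stepEdge_cons_zero, stepEdge_cons_succ, eq_comm]

theorem mem_edgeSet_iff [DecidableEq V] (w : Fin (L + 1) → V) (e : Sym2 V) :
    e ∈ edgeSet w ↔ edgeMult w e ≠ 0 := by
  simp [edgeSet, edgeMult, Finset.filter_eq_empty_iff]

theorem mem_range_of_mem_edgeSet [DecidableEq V] {w : Fin (L + 1) → V} {a b : V}
    (h : s(a, b) ∈ edgeSet w) : a ∈ Set.range w := by
  simp only [edgeSet, mem_image, mem_univ, true_and, stepEdge, Sym2.eq_iff] at h
  obtain ⟨i, ⟨h, -⟩ | ⟨-, h⟩⟩ := h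
  · exact ⟨_, h⟩
  · exact ⟨_, h⟩

theorem image_cons [DecidableEq V] (a : V) (w : Fin (L + 1) → V) :
    univ.image (Fin.cons a w : Fin (L + 1 + 1) → V) = insert a (univ.image w) := by
  ext e
  simp only [mem_image, mem_univ, true_and, mem_insert, Fin.exists_fin_succ,
    Fin.cons_zero, Fin.cons_succ, eq_comm]

/-- Prepending a vertex not yet visited also adds a new edge, as in any connected graph. -/
theorem card_image_le_card_edgeSet [DecidableEq V] :
    ∀ {L : ℕ} (w : Fin (L + 1) → V), (univ.image w).card ≤ (edgeSet w).card + 1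
  | 0, w => by
    refine card_image_le.trans ?_
    simp
  | L + 1, w => by
    obtain ⟨a, w, rfl⟩ : ∃ a w', w = Fin.cons a w' := ⟨w 0, Fin.tail w, (Fin.cons_self_tail w).symm⟩
    rw [image_cons, edgeSet_cons]
    have ih := card_image_le_card_edgeSet w
    by_cases h : a ∈ univ.image w
    · rw [insert_eq_of_mem h]
      exact ih.trans (by gcongr; exact subset_insert _ _)
    · rw [card_insert_of_notMem h, card_insert_of_notMem]
      · omega
      · intro h2
        apply h
        simpa using mem_range_of_mem_edgeSet h2

theorem GoodWalk.two_mul_card_edgeSet_le [DecidableEq V] {w : Fin (L + 1) → V} (h : GoodWalk w) :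
    2 * (edgeSet w).card ≤ L := by
  have := mul_card_image_le_card (s := (univ : Finset (Fin L))) (f := stepEdge w) (n := 2) ?_
  · simpa [edgeSet] using this
  · intro e he
    have h0 := (mem_edgeSet_iff w e).1 he
    have h1 := h.2.2 e
    change 2 ≤ edgeMult w e
    omega

theorem GoodWalk.card_image_le [DecidableEq V] {q : ℕ} {w : Fin (2 * q + 1) → V} (h : GoodWalk w) :
    (univ.image w).card ≤ q + 1 := by
  have h1 := h.two_mul_card_edgeSet_le
  have h2 := card_image_le_card_edgeSet w
  omega

theorem ker_eq_iff {w : Fin (L + 1) → V} {v : Fin (L + 1) → U} :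
    Setoid.ker w = Setoid.ker v ↔ ∀ i j, w i = w j ↔ v i = v j := by
  rw [Setoid.ext_iff]
  rfl

theorem stepEdge_eq_iff_of_ker_eq {w : Fin (L + 1) → V} {v : Fin (L + 1) → U}
    (h : Setoid.ker w = Setoid.ker v) (i j : Fin L) :
    stepEdge w i = stepEdge w j ↔ stepEdge v i = stepEdge v j := by
  rw [ker_eq_iff] at h
  simp only [stepEdge, Sym2.eq_iff, h]

/-- Goodness depends only on which positions of the walk coincide, so it transfers between vertex
sets. -/
theorem GoodWalk.of_ker_eq [DecidableEq V] [DecidableEq U] {w : Fin (L + 1) → V}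
    {v : Fin (L + 1) → U} (h : Setoid.ker w = Setoid.ker v) (hw : GoodWalk w) : GoodWalk v := by
  have h' := ker_eq_iff.1 h
  refine ⟨(h' _ _).1 hw.1, fun i hi => hw.2.1 i ((h' _ _).2 hi), fun e he => ?_⟩
  have he2 : e ∈ edgeSet v := by rw [mem_edgeSet_iff]; omega
  simp only [edgeSet, mem_image, mem_univ, true_and] at he2
  obtain ⟨i, rfl⟩ := he2
  apply hw.2.2 (stepEdge w i)
  rw [← he, edgeMult, edgeMult]
  congr 1
  ext j
  simp [stepEdge_eq_iff_of_ker_eq h]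

open scoped Classical in
/-- The sum over the walks with a given kernel of the product of the weights of their edges. -/
theorem sum_ker_eq_prod_edgeSet_le [Fintype V] [DecidableEq V] [DecidableEq U] (p : Sym2 V → ℝ)
    (hp0 : ∀ e, 0 ≤ p e) (hp1 : ∀ e, p e ≤ 1) (D : ℝ) (hD : 0 ≤ D)
    (hpD : ∀ b, ∑ a, p s(a, b) ≤ D) :
    ∀ {L : ℕ} (v : Fin (L + 1) → U),
      D * ∑ w : Fin (L + 1) → V with Setoid.ker w = Setoid.ker v, ∏ e ∈ edgeSet w, p e ≤
        Fintype.card V * D ^ (univ.image v).card := by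
  classical
  intro L
  induction L with
  | zero =>
    intro v
    have h1 : (univ.image v).card = 1 := by
      rw [card_eq_one]
      exact ⟨v 0, by ext; simp⟩
    rw [h1, pow_one, mul_comm]
    gcongr
    refine (sum_le_sum (g := fun _ => (1 : ℝ)) fun w _ => prod_le_one (fun e _ => hp0 e)
      fun e _ => hp1 e).trans ?_
    rw [sum_const, nsmul_eq_mul, mul_one]
    exact_mod_cast (card_filter_le _ _).trans (by simp)
  | succ L ih =>
    intro v
    obtain ⟨b, v, rfl⟩ : ∃ a w', v = Fin.cons a w' := ⟨v 0, Fin.tail v, (Fin.cons_self_tail v).symm⟩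
    have key : ∀ (a : V) (w : Fin (L + 1) → V),
        Setoid.ker (Fin.cons a w : Fin (L + 1 + 1) → V) =
          Setoid.ker (Fin.cons b v : Fin (L + 1 + 1) → U) ↔
        (Setoid.ker w = Setoid.ker v ∧ ∀ j, a = w j ↔ b = v j) := by
      intro a w
      simp only [ker_eq_iff]
      constructor
      · intro h
        exact ⟨fun i j => by simpa using h i.succ j.succ, fun j => by simpa using h 0 j.succ⟩
      · rintro ⟨h1, h2⟩ i j
        induction i using Fin.cases with
        | zero =>
          induction j using Fin.cases with
          | zero => simp
          | succ j => simpa using h2 j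
        | succ i =>
          induction j using Fin.cases with
          | zero => simpa [eq_comm] using h2 i
          | succ j => simpa using h1 i j
    have hF : ∀ w : Fin (L + 1) → V, 0 ≤ ∏ e ∈ edgeSet w, p e :=
      fun w => prod_nonneg fun e _ => hp0 e
    rw [image_cons, sum_filter, ← (Fin.consEquiv fun _ => V).sum_comp, Fintype.sum_prod_type_right]
    have hcons : ∀ (w : Fin (L + 1) → V) (a : V),
        (if Setoid.ker ((Fin.consEquiv fun _ => V) (a, w)) =
            Setoid.ker (Fin.cons b v : Fin (L + 1 + 1) → U) then
          ∏ e ∈ edgeSet ((Fin.consEquiv fun _ => V) (a, w)), p e else 0) =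
        if Setoid.ker w = Setoid.ker v ∧ ∀ j, a = w j ↔ b = v j then
          ∏ e ∈ insert s(a, w 0) (edgeSet w), p e else 0 := fun w a => by
      rw [← edgeSet_cons]
      exact if_congr (key a w) rfl rfl
    simp only [hcons]
    -- If the first vertex recurs later, the pattern determines its position, and a possible extra
    -- edge weighs at most 1.
    by_cases hb : b ∈ univ.image v
    · rw [insert_eq_of_mem hb]
      refine le_trans (mul_le_mul_of_nonneg_left ?_ hD) (ih v)
      rw [sum_filter]
      refine sum_le_sum fun w _ => ?_
      by_cases hw : Setoid.ker w = Setoid.ker v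
      · simp only [hw, true_and, if_true]
        obtain ⟨j, -, hj⟩ := mem_image.1 hb
        refine (sum_le_sum (g := fun a => if a = w j then ∏ e ∈ edgeSet w, p e else 0)
          fun a _ => ?_).trans (by simp)
        by_cases ha : a = w j
        · rw [if_pos ha]
          split_ifs
          · by_cases he : s(a, w 0) ∈ edgeSet w
            · rw [insert_eq_of_mem he]
            · rw [prod_insert he]
              exact mul_le_of_le_one_left (hF w) (hp1 _)
          · exact hF w
        · rw [if_neg ha, if_neg]
          intro h
          exact ha ((h j).2 hj.symm)
      · simp [hw]
    -- A fresh vertex brings an edge outside `edgeSet w`; summing over its positions costs at most a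
    -- factor `D`.
    · rw [card_insert_of_notMem hb, pow_succ, ← mul_assoc, mul_comm]
      refine le_trans ?_ (mul_le_mul_of_nonneg_right (ih v) hD)
      rw [mul_assoc, mul_comm D (_ * D)]
      refine mul_le_mul_of_nonneg_right ?_ hD
      rw [sum_filter, sum_mul]
      refine sum_le_sum fun w _ => ?_
      by_cases hw : Setoid.ker w = Setoid.ker v
      · simp only [hw, true_and, if_true]
        have hb' : ∀ j, b ≠ v j := fun j hj => hb (by simp [hj])
        refine (sum_le_sum (g := fun a => (∏ e ∈ edgeSet w, p e) * p s(a, w 0))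
          fun a _ => ?_).trans ?_
        · split_ifs with h
          · rw [prod_insert, mul_comm]
            intro hmem
            obtain ⟨j, hj⟩ := mem_range_of_mem_edgeSet hmem
            exact hb' j ((h j).1 hj.symm)
          · exact mul_nonneg (hF w) (hp0 _)
        · rw [← mul_sum]
          exact mul_le_mul_of_nonneg_left (hpD _) (hF w)
      · simp [hw]

-- Relabelling the vertices of `w` by an injection into `U` preserves its pattern, and distinct
-- injections give distinct walks.
open scoped Classical in
theorem descFactorial_le_card_ker_eq [Fintype U] [DecidableEq V] (w : Fin (L + 1) → V) :
    (Fintype.card U).descFactorial (univ.image w).card ≤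
      (univ.filter fun v : Fin (L + 1) → U => Setoid.ker v = Setoid.ker w).card := by
  rw [← Fintype.card_coe (univ.image w), ← Fintype.card_embedding_eq, ← Finset.card_univ]
  refine card_le_card_of_injOn
    (fun f i => f ⟨w i, mem_image_of_mem w (mem_univ i)⟩) (fun f _ => ?_) (fun f _ g _ h => ?_)
  · simp [ker_eq_iff]
  · ext ⟨x, hx⟩
    obtain ⟨i, -, rfl⟩ := mem_image.1 hx
    exact congrFun h i

open scoped Classical in
/-- Comparison of the weighted number of good walks with the number of good walks in a complete
graph. -/
theorem sum_goodWalk_prod_edgeSet_le [Fintype V] [DecidableEq V] [Fintype U] [DecidableEq U]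
    (p : Sym2 V → ℝ) (hp0 : ∀ e, 0 ≤ p e) (hp1 : ∀ e, p e ≤ 1) (D q : ℕ) (hD : 0 < D)
    (hpD : ∀ b, ∑ a, p s(a, b) ≤ D) (hU : D + q ≤ Fintype.card U) :
    ∑ w : Fin (2 * q + 1) → V with GoodWalk w, ∏ e ∈ edgeSet w, p e ≤
      Fintype.card V * (univ.filter fun v : Fin (2 * q + 1) → U => GoodWalk v).card := by
  have hD1 : (1 : ℝ) ≤ D := by exact_mod_cast hD
  set G := univ.filter fun w : Fin (2 * q + 1) → V => GoodWalk w
  set G' := univ.filter fun v : Fin (2 * q + 1) → U => GoodWalk v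
  set S : Finset (Setoid (Fin (2 * q + 1))) := G.image Setoid.ker
  have h1 : ∀ π ∈ S, ∑ w ∈ G with Setoid.ker w = π, ∏ e ∈ edgeSet w, p e ≤
      Fintype.card V * ((G'.filter fun v => Setoid.ker v = π).card : ℝ) := by
    intro π hπ
    obtain ⟨w₀, hw₀, rfl⟩ := mem_image.1 hπ
    have hg : GoodWalk w₀ := (mem_filter.1 hw₀).2
    have h2 := sum_ker_eq_prod_edgeSet_le p hp0 hp1 D (by positivity) hpD w₀
    have h3 : ∑ w ∈ G with Setoid.ker w = Setoid.ker w₀, ∏ e ∈ edgeSet w, p e ≤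
        ∑ w : Fin (2 * q + 1) → V with Setoid.ker w = Setoid.ker w₀, ∏ e ∈ edgeSet w, p e :=
      sum_le_sum_of_subset_of_nonneg (filter_subset_filter _ (subset_univ _))
        fun w _ _ => prod_nonneg fun e _ => hp0 e
    have h4 : G'.filter (fun v => Setoid.ker v = Setoid.ker w₀) =
        univ.filter fun v : Fin (2 * q + 1) → U => Setoid.ker v = Setoid.ker w₀ := by
      ext v
      simp only [G', mem_filter, mem_univ, true_and, and_iff_right_iff_imp]
      exact fun h => hg.of_ker_eq h.symm
    have h5 : D ^ (univ.image w₀).card ≤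
        (univ.filter fun v : Fin (2 * q + 1) → U => Setoid.ker v = Setoid.ker w₀).card := by
      refine le_trans ?_ (descFactorial_le_card_ker_eq w₀)
      -- With at most `q + 1` distinct vertices, every factor of the descending factorial is at
      -- least `(D + q) + 1 - (q + 1) = D`.
      refine le_trans ?_ (Nat.pow_sub_le_descFactorial _ _)
      refine Nat.pow_le_pow_left ?_ _
      have := hg.card_image_le
      omega
    rw [h4]
    refine h3.trans ?_
    have h6 : ∑ w : Fin (2 * q + 1) → V with Setoid.ker w = Setoid.ker w₀,
        ∏ e ∈ edgeSet w, p e ≤ Fintype.card V * (D : ℝ) ^ (univ.image w₀).card :=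
      le_trans (le_mul_of_one_le_left
        (sum_nonneg fun w _ => prod_nonneg fun e _ => hp0 e) hD1) h2
    refine h6.trans ?_
    gcongr
    exact_mod_cast h5
  calc ∑ w ∈ G, ∏ e ∈ edgeSet w, p e
      = ∑ π ∈ S, ∑ w ∈ G with Setoid.ker w = π, ∏ e ∈ edgeSet w, p e :=
        (sum_fiberwise_of_maps_to (fun w hw => mem_image_of_mem _ hw) _).symm
    _ ≤ ∑ π ∈ S, Fintype.card V * ((G'.filter fun v => Setoid.ker v = π).card : ℝ) :=
        sum_le_sum h1
    _ = Fintype.card V * ((∑ π ∈ S, (G'.filter fun v => Setoid.ker v = π).card : ℕ) : ℝ) := by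
        rw [← mul_sum]; push_cast; rfl
    _ ≤ Fintype.card V * (G'.card : ℝ) := by
        have h7 : ∑ π ∈ S, (G'.filter fun v => Setoid.ker v = π).card =
            (G'.filter fun v => Setoid.ker v ∈ S).card := by
          convert sum_card_fiberwise_eq_card_filter G' S Setoid.ker
        rw [h7]
        gcongr
        exact filter_subset _ _

/-- The entries of a matrix power as sums over walks. -/
theorem pow_apply_eq_sum_walk [Fintype V] [DecidableEq V] (M : Matrix V V ℝ) :
    ∀ (L : ℕ) (a b : V), (M ^ L) a b = ∑ w : Fin (L + 1) → V,
      if w 0 = a ∧ w (Fin.last L) = b then ∏ i : Fin L, M (w i.castSucc) (w i.succ) else 0 := by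
  intro L
  induction L with
  | zero =>
    intro a b
    rw [← (Equiv.funUnique (Fin 1) V).symm.sum_comp]
    simp only [pow_zero, Matrix.one_apply, univ_eq_empty, prod_empty]
    by_cases h : a = b
    · subst h
      simp
    · rw [if_neg h]
      refine (sum_eq_zero fun x _ => if_neg ?_).symm
      rintro ⟨rfl, rfl⟩
      exact h rfl
  | succ L ih =>
    intro a b
    rw [pow_succ', Matrix.mul_apply, ← (Fin.consEquiv fun _ => V).sum_comp,
      Fintype.sum_prod_type_right]
    simp only [ih, mul_sum]
    rw [sum_comm]
    refine sum_congr rfl fun w _ => ?_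
    simp only [Fin.consEquiv_apply, Fin.cons_zero, Fin.prod_univ_succ, Fin.castSucc_zero,
      Fin.cons_succ, ← Fin.succ_last, ← Fin.succ_castSucc]
    by_cases h : w (Fin.last L) = b <;> simp [h]

theorem trace_pow_eq_sum_walk [Fintype V] [DecidableEq V] (M : Matrix V V ℝ) (L : ℕ) :
    (M ^ L).trace = ∑ w : Fin (L + 1) → V,
      if w 0 = w (Fin.last L) then ∏ i : Fin L, M (w i.castSucc) (w i.succ) else 0 := by
  simp only [Matrix.trace, Matrix.diag_apply, pow_apply_eq_sum_walk]
  rw [sum_comm]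
  refine sum_congr rfl fun w _ => ?_
  simp [ite_and, eq_comm]

/-- The symmetric matrix with zero diagonal and given values on the edges of the complete
graph. -/
def edgeMatrix [DecidableEq V] (x : {e : Sym2 V // ¬e.IsDiag} → ℝ) : Matrix V V ℝ :=
  Matrix.of fun a b => if h : a = b then 0 else x ⟨s(a, b), h⟩

theorem edgeMatrix_transpose [DecidableEq V] (x : {e : Sym2 V // ¬e.IsDiag} → ℝ) :
    (edgeMatrix x).transpose = edgeMatrix x := by
  ext a b
  by_cases h : a = b
  · simp [edgeMatrix, h]
  · simp [edgeMatrix, h, Ne.symm h, Sym2.eq_swap (a := a)]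

theorem prod_edgeMatrix [Fintype V] [DecidableEq V] (x : {e : Sym2 V // ¬e.IsDiag} → ℝ)
    (w : Fin (L + 1) → V) :
    ∏ i : Fin L, edgeMatrix x (w i.castSucc) (w i.succ) =
      if ∀ i : Fin L, w i.castSucc ≠ w i.succ then ∏ e, x e ^ edgeMult w e.1 else 0 := by
  split_ifs with h
  · have h1 : ∀ i : Fin L, edgeMatrix x (w i.castSucc) (w i.succ) = x ⟨stepEdge w i, h i⟩ :=
      fun i => by simp [edgeMatrix, h i, stepEdge]
    simp only [h1]
    rw [← Fintype.prod_fiberwise' (fun i => (⟨stepEdge w i, h i⟩ : {e : Sym2 V // ¬e.IsDiag})) x]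
    refine prod_congr rfl fun e _ => ?_
    rw [prod_const, edgeMult, Finset.card_univ, Fintype.card_subtype]
    simp [Subtype.ext_iff]
  · push Not at h
    obtain ⟨i, hi⟩ := h
    exact prod_eq_zero (mem_univ i) (by simp [edgeMatrix, hi])

end Walks
-- The subgaussian comparison matrix
section ComparisonModel

open Finset Function

/-- The values `2, -1, -1` of a centred variable, uniform on three points, whose other moments are
at least `1`. -/
def threeVal : Fin 3 → ℝ := ![2, -1, -1]

theorem sum_threeVal_pow (k : ℕ) : ∑ j, threeVal j ^ k = 2 ^ k + 2 * (-1) ^ k := by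
  simp [threeVal, Fin.sum_univ_three]
  ring

theorem sum_threeVal_pow_one : ∑ j, threeVal j ^ 1 = 0 := by
  rw [sum_threeVal_pow]
  norm_num

/-- A good walk may use an edge three times, so random signs, whose odd moments vanish, would not
serve; the skewed values make the third and later odd moments positive. -/
theorem three_le_sum_threeVal_pow {k : ℕ} (hk : k ≠ 1) : 3 ≤ ∑ j, threeVal j ^ k := by
  rw [sum_threeVal_pow]
  rcases Nat.lt_or_ge k 3 with h | h
  · interval_cases k <;> norm_num at *
  · have h1 : (2 : ℝ) ^ 3 ≤ 2 ^ k := pow_le_pow_right₀ (by norm_num) h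
    rcases neg_one_pow_eq_or ℝ k with h2 | h2 <;> rw [h2] <;> linarith

/-- The linear term cancels on averaging a centred variable, which leaves a subgaussian bound. -/
theorem exp_le_add_exp_sq (x : ℝ) : Real.exp x ≤ x + Real.exp (x ^ 2) := by
  have h0 : x ^ 2 + 1 ≤ Real.exp (x ^ 2) := Real.add_one_le_exp _
  rcases le_or_gt |x| 1 with h | h
  · have h1 := (abs_le.1 (Real.abs_exp_sub_one_sub_id_le h)).2
    linarith
  · rcases lt_abs.1 h with h | h
    · have h1 : Real.exp x ≤ Real.exp (x ^ 2) := Real.exp_le_exp.2 (by nlinarith)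
      linarith
    · have h1 : Real.exp x ≤ 1 := Real.exp_le_one_iff.2 (by linarith)
      nlinarith

theorem sum_exp_mul_threeVal_le (s : ℝ) :
    ∑ j, Real.exp (threeVal j * s) ≤ 3 * Real.exp (4 * s ^ 2) := by
  have h1 := exp_le_add_exp_sq (2 * s)
  have h2 := exp_le_add_exp_sq (-s)
  have h3 : Real.exp ((2 * s) ^ 2) = Real.exp (4 * s ^ 2) := by ring_nf
  have h4 : Real.exp ((-s) ^ 2) ≤ Real.exp (4 * s ^ 2) :=
    Real.exp_le_exp.2 (by nlinarith [sq_nonneg s])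
  simp only [threeVal, Fin.sum_univ_three, Matrix.cons_val_zero, Matrix.cons_val_one,
    Matrix.cons_val, neg_one_mul]
  linarith

variable {V : Type*} [Fintype V] [DecidableEq V]

/-- The matrix of the comparison model. -/
def compMatrix (ω : {e : Sym2 V // ¬e.IsDiag} → Fin 3) : Matrix V V ℝ :=
  edgeMatrix fun e => threeVal (ω e)

-- Each closed walk contributes a product of moments: all normalised moments are at least 1 for a
-- good walk, and the product is nonnegative in any case. Averages are kept as sums over all
-- configurations, whence the power of 3.
open scoped Classical in
theorem card_goodWalk_le_sum_trace (L : ℕ) :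
    (3 : ℝ) ^ Fintype.card {e : Sym2 V // ¬e.IsDiag} *
      (univ.filter fun w : Fin (L + 1) → V => GoodWalk w).card ≤
    ∑ ω : {e : Sym2 V // ¬e.IsDiag} → Fin 3, (compMatrix ω ^ L).trace := by
  simp only [trace_pow_eq_sum_walk]
  rw [sum_comm, card_filter, Nat.cast_sum, mul_sum]
  refine sum_le_sum fun w _ => ?_
  by_cases hc : w 0 = w (Fin.last L)
  swap
  · simp [hc, GoodWalk]
  by_cases hl : ∀ i : Fin L, w i.castSucc ≠ w i.succ
  swap
  · rw [if_neg fun h : GoodWalk w => hl h.2.1]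
    simp only [compMatrix, prod_edgeMatrix, if_neg hl]
    simp
  simp only [if_pos hc, compMatrix, prod_edgeMatrix, if_pos hl]
  rw [← Fintype.prod_sum (fun (e : {e : Sym2 V // ¬e.IsDiag}) j => threeVal j ^ edgeMult w e.1)]
  split_ifs with hg
  · rw [Nat.cast_one, mul_one, ← Finset.card_univ, ← prod_const]
    exact prod_le_prod (fun _ _ => by norm_num)
      fun e _ => three_le_sum_threeVal_pow (hg.2.2 e.1)
  · simp only [Nat.cast_zero, mul_zero]
    refine prod_nonneg fun e _ => ?_
    by_cases h : edgeMult w e.1 = 1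
    · rw [h, sum_threeVal_pow_one]
    · exact le_trans (by norm_num) (three_le_sum_threeVal_pow h)

/-- The coefficient of the edge `e` in the bilinear form of a symmetric matrix. -/
def edgeCoeff (x y : V → ℝ) (e : Sym2 V) : ℝ :=
  ∑ ab : V × V with s(ab.1, ab.2) = e, x ab.1 * y ab.2

theorem dotProduct_edgeMatrix_mulVec (u : {e : Sym2 V // ¬e.IsDiag} → ℝ) (x y : V → ℝ) :
    x ⬝ᵥ (edgeMatrix u).mulVec y = ∑ e, u e * edgeCoeff x y e.1 := by
  have h1 : x ⬝ᵥ (edgeMatrix u).mulVec y =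
      ∑ e : Sym2 V, ∑ ab : V × V with s(ab.1, ab.2) = e,
        x ab.1 * y ab.2 * edgeMatrix u ab.1 ab.2 := by
    rw [sum_fiberwise, Fintype.sum_prod_type]
    simp only [dotProduct, Matrix.mulVec, mul_sum]
    exact sum_congr rfl fun a _ => sum_congr rfl fun b _ => by ring
  rw [h1, ← sum_filter_of_ne (p := fun e : Sym2 V => ¬e.IsDiag),
    sum_subtype (p := fun e : Sym2 V => ¬e.IsDiag) _ (by simp)]
  · refine sum_congr rfl fun e _ => ?_
    rw [edgeCoeff, mul_sum]
    refine sum_congr rfl fun ab hab => ?_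
    have he := (mem_filter.1 hab).2
    have hne : ab.1 ≠ ab.2 := fun h => e.2 (by rw [← he, h]; simp)
    have hM : edgeMatrix u ab.1 ab.2 = u e := by
      simp [edgeMatrix, hne, he]
    rw [hM]
    ring
  · intro e _ he hd
    apply he
    refine sum_eq_zero fun ab hab => ?_
    have hab' := (mem_filter.1 hab).2
    rw [← hab', Sym2.mk_isDiag_iff] at hd
    simp [edgeMatrix, hd]

/-- At most two ordered pairs lie over an unordered edge, so Cauchy–Schwarz loses a factor 2. -/
theorem sum_edgeCoeff_sq_le (x y : V → ℝ) :
    ∑ e : {e : Sym2 V // ¬e.IsDiag}, edgeCoeff x y e.1 ^ 2 ≤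
      2 * ((∑ a, x a ^ 2) * ∑ b, y b ^ 2) := by
  have hcard : ∀ e : Sym2 V, (univ.filter fun ab : V × V => s(ab.1, ab.2) = e).card ≤ 2 := by
    intro e
    induction e with | _ a b
    refine (card_le_card (t := {(a, b), (b, a)}) ?_).trans card_le_two
    rintro ⟨c, d⟩ h
    simpa using h
  calc ∑ e : {e : Sym2 V // ¬e.IsDiag}, edgeCoeff x y e.1 ^ 2
      ≤ ∑ e : Sym2 V, edgeCoeff x y e ^ 2 := by
        rw [← sum_subtype (univ.filter fun e : Sym2 V => ¬e.IsDiag) (by simp)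
          fun e => edgeCoeff x y e ^ 2]
        exact sum_le_sum_of_subset_of_nonneg (filter_subset _ _) fun _ _ _ => sq_nonneg _
    _ ≤ ∑ e : Sym2 V, 2 * ∑ ab : V × V with s(ab.1, ab.2) = e, (x ab.1 * y ab.2) ^ 2 := by
        refine sum_le_sum fun e _ => sq_sum_le_card_mul_sum_sq.trans ?_
        refine mul_le_mul_of_nonneg_right (by exact_mod_cast hcard e)
          (sum_nonneg fun _ _ => sq_nonneg _)
    _ = 2 * ((∑ a, x a ^ 2) * ∑ b, y b ^ 2) := by
        rw [← mul_sum, sum_fiberwise, Fintype.sum_prod_type, sum_mul_sum]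
        simp only [mul_pow]

theorem sum_exp_dotProduct_compMatrix_le (x y : V → ℝ) (t : ℝ) :
    ∑ ω, Real.exp (t * (x ⬝ᵥ (compMatrix ω).mulVec y)) ≤
      3 ^ Fintype.card {e : Sym2 V // ¬e.IsDiag} *
        Real.exp (8 * t ^ 2 * ((∑ a, x a ^ 2) * ∑ b, y b ^ 2)) := by
  have h1 : ∀ ω, Real.exp (t * (x ⬝ᵥ (compMatrix ω).mulVec y)) =
      ∏ e : {e : Sym2 V // ¬e.IsDiag}, Real.exp (threeVal (ω e) * (t * edgeCoeff x y e.1)) := by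
    intro ω
    rw [compMatrix, dotProduct_edgeMatrix_mulVec, mul_sum, Real.exp_sum]
    exact prod_congr rfl fun e _ => by ring_nf
  simp only [h1]
  rw [← Fintype.prod_sum (fun (e : {e : Sym2 V // ¬e.IsDiag}) j =>
    Real.exp (threeVal j * (t * edgeCoeff x y e.1)))]
  refine (prod_le_prod (fun e _ => sum_nonneg fun j _ => (Real.exp_pos _).le)
    fun e _ => sum_exp_mul_threeVal_le _).trans ?_
  rw [prod_mul_distrib, prod_const, Finset.card_univ, ← Real.exp_sum]
  gcongr
  rw [← mul_sum]
  simp only [mul_pow]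
  rw [← mul_sum]
  nlinarith [sum_edgeCoeff_sq_le x y, sq_nonneg t]

theorem pow_two_mul_le_factorial_mul_exp (u : ℝ) (q : ℕ) :
    u ^ (2 * q) ≤ (2 * q).factorial * (Real.exp u + Real.exp (-u)) := by
  have h1 := Real.pow_div_factorial_le_exp |u| (abs_nonneg u) (2 * q)
  rw [pow_mul, sq_abs, ← pow_mul, div_le_iff₀' (by positivity)] at h1
  refine h1.trans ?_
  gcongr
  rcases abs_choice u with h | h <;> rw [h] <;> linarith [Real.exp_pos u, Real.exp_pos (-u)]

theorem sum_dotProduct_compMatrix_pow_le (x y : V → ℝ) (hx : ∑ a, x a ^ 2 ≤ 4)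
    (hy : ∑ a, y a ^ 2 ≤ 4) (q : ℕ) (hq : 0 < q) :
    ∑ ω, (x ⬝ᵥ (compMatrix ω).mulVec y) ^ (2 * q) ≤
      3 ^ Fintype.card {e : Sym2 V // ¬e.IsDiag} * (2 * (4 * Real.exp 128 * q) ^ q) := by
  have hq' : (0 : ℝ) < q := by exact_mod_cast hq
  have hsq : √(q : ℝ) ^ 2 = q := Real.sq_sqrt hq'.le
  have hxy : (∑ a, x a ^ 2) * ∑ b, y b ^ 2 ≤ 16 := by
    nlinarith [sum_nonneg fun a (_ : a ∈ univ) => sq_nonneg (x a),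
      sum_nonneg fun a (_ : a ∈ univ) => sq_nonneg (y a)]
  set N : ℝ := 3 ^ Fintype.card {e : Sym2 V // ¬e.IsDiag} with hN
  -- Exponential moments are taken at `t = ±√q`; the exponent is `8 * q * 16 = 128 * q`.
  have hexp : ∀ t : ℝ, t ^ 2 = q →
      ∑ ω, Real.exp (t * (x ⬝ᵥ (compMatrix ω).mulVec y)) ≤ N * Real.exp (128 * q) := by
    intro t ht
    refine (sum_exp_dotProduct_compMatrix_le x y t).trans
      (mul_le_mul_of_nonneg_left (Real.exp_le_exp.2 ?_) (by positivity))
    rw [ht]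
    nlinarith
  have h1 : (q : ℝ) ^ q * ∑ ω, (x ⬝ᵥ (compMatrix ω).mulVec y) ^ (2 * q) ≤
      (2 * q).factorial * (N * Real.exp (128 * q) + N * Real.exp (128 * q)) := by
    calc (q : ℝ) ^ q * ∑ ω, (x ⬝ᵥ (compMatrix ω).mulVec y) ^ (2 * q)
        = ∑ ω, (√(q : ℝ) * (x ⬝ᵥ (compMatrix ω).mulVec y)) ^ (2 * q) := by
          rw [mul_sum]
          refine sum_congr rfl fun ω _ => ?_
          rw [mul_pow, pow_mul √(q : ℝ), hsq]
      _ ≤ ∑ ω, ((2 * q).factorial : ℝ) * (Real.exp (√(q : ℝ) * (x ⬝ᵥ (compMatrix ω).mulVec y)) +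
            Real.exp (-√(q : ℝ) * (x ⬝ᵥ (compMatrix ω).mulVec y))) := by
          refine sum_le_sum fun ω _ => ?_
          rw [neg_mul]
          exact pow_two_mul_le_factorial_mul_exp _ _
      _ ≤ _ := by
          rw [← mul_sum, sum_add_distrib]
          gcongr
          · exact hexp _ hsq
          · exact hexp _ (by rw [neg_sq, hsq])
  have h2 : ((2 * q).factorial : ℝ) ≤ (2 * q) ^ (2 * q) := by
    exact_mod_cast Nat.factorial_le_pow (2 * q)
  have h3 : (q : ℝ) ^ q * (∑ ω, (x ⬝ᵥ (compMatrix ω).mulVec y) ^ (2 * q)) ≤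
      q ^ q * (N * (2 * (4 * Real.exp 128 * q) ^ q)) := by
    refine h1.trans ((mul_le_mul_of_nonneg_right h2 (by positivity)).trans (le_of_eq ?_))
    rw [mul_pow, mul_pow, mul_pow, ← Real.exp_nat_mul, pow_mul (2 : ℝ), two_mul q, pow_add]
    ring_nf
  exact le_of_mul_le_mul_left h3 (by positivity)

end ComparisonModel

/-! ### Nets and operator norms -/

section Net

open Finset

variable {E : Type*} [NormedAddCommGroup E] [InnerProductSpace ℝ E]

/-- A 1-separated set of maximal cardinality in the ball is a net; the cardinality bound is the
volume bound for separated sets. -/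
theorem exists_net_closedBall_two (E : Type*) [NormedAddCommGroup E] [NormedSpace ℝ E]
    [FiniteDimensional ℝ E] :
    ∃ s : Finset E, s.card ≤ 5 ^ Module.finrank ℝ E ∧ (∀ c ∈ s, ‖c‖ ≤ 2) ∧
      ∀ x : E, ‖x‖ ≤ 2 → ∃ c ∈ s, ‖x - c‖ < 1 := by
  classical
  let Sep : Finset E → Prop := fun s =>
    (∀ c ∈ s, ‖c‖ ≤ 2) ∧ ∀ c ∈ s, ∀ d ∈ s, c ≠ d → 1 ≤ ‖c - d‖
  have hbdd : BddAbove {k | ∃ s, Sep s ∧ s.card = k} := by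
    refine ⟨5 ^ Module.finrank ℝ E, ?_⟩
    rintro k ⟨s, hs, rfl⟩
    exact Besicovitch.card_le_of_separated s hs.1 hs.2
  obtain ⟨s, hs, hmax⟩ := Nat.sSup_mem (s := {k | ∃ s, Sep s ∧ s.card = k})
    ⟨0, ∅, by simp [Sep], rfl⟩ hbdd
  refine ⟨s, Besicovitch.card_le_of_separated s hs.1 hs.2, hs.1, fun x hx => ?_⟩
  by_contra! hcon
  have hxs : x ∉ s := fun h => by
    have := hcon x h
    norm_num at this
  have hins : Sep (insert x s) := by
    refine ⟨fun c hc => ?_, fun c hc d hd hcd => ?_⟩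
    · rcases mem_insert.1 hc with h | hc
      · rwa [h]
      · exact hs.1 c hc
    · rcases mem_insert.1 hc with h | hc <;> rcases mem_insert.1 hd with h' | hd
      · exact absurd (h.trans h'.symm) hcd
      · rw [h]
        exact hcon d hd
      · rw [h', norm_sub_rev]
        exact hcon c hc
      · exact hs.2 c hc d hd hcd
  have := le_csSup hbdd ⟨_, hins, rfl⟩
  rw [← hmax, card_insert_of_notMem hxs] at this
  omega

/-- Radius 2 avoids any loss: a net point within 1 of `2 z / ‖z‖` pairs with `z` to at least `2 ‖z‖
- ‖z‖`. -/
theorem exists_norm_le_inner_of_net {s : Finset E}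
    (hs : ∀ x : E, ‖x‖ ≤ 2 → ∃ c ∈ s, ‖x - c‖ < 1) (z : E) : ∃ c ∈ s, ‖z‖ ≤ inner ℝ c z := by
  by_cases hz : z = 0
  · obtain ⟨c, hc, -⟩ := hs 0 (by simp)
    exact ⟨c, hc, by simp [hz]⟩
  have hz' : 0 < ‖z‖ := norm_pos_iff.2 hz
  obtain ⟨c, hc, h⟩ := hs ((2 / ‖z‖) • z) (by
    rw [norm_smul, norm_div, norm_norm, div_mul_cancel₀ _ hz'.ne']; simp)
  refine ⟨c, hc, ?_⟩
  have h1 : inner ℝ ((2 / ‖z‖) • z) z = 2 * ‖z‖ := by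
    rw [real_inner_smul_left, real_inner_self_eq_norm_sq]
    field_simp
  have h2 := real_inner_le_norm ((2 / ‖z‖) • z - c) z
  rw [inner_sub_left, h1] at h2
  nlinarith

theorem exists_opNorm_le_inner_of_net {s : Finset E}
    (hs : ∀ x : E, ‖x‖ ≤ 2 → ∃ c ∈ s, ‖x - c‖ < 1) (T : E →L[ℝ] E) :
    ∃ c ∈ s, ∃ d ∈ s, ‖T‖ ≤ inner ℝ c (T d) := by
  have hne : s.Nonempty := by
    obtain ⟨c, hc, -⟩ := hs 0 (by simp)
    exact ⟨c, hc⟩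
  obtain ⟨d, hd, hmax⟩ := exists_max_image s (fun d => ‖T d‖) hne
  obtain ⟨c, hc, h⟩ := exists_norm_le_inner_of_net hs (T d)
  refine ⟨c, hc, d, hd, le_trans ?_ h⟩
  -- Approximating `2 u` by a net point, for `u` a unit vector, gives `2 ‖T u‖ ≤ ‖T d‖ + ‖T‖`.
  have h1 : ‖T‖ ≤ (‖T d‖ + ‖T‖) / 2 := by
    refine ContinuousLinearMap.opNorm_le_of_unit_norm (by positivity) fun u hu => ?_
    obtain ⟨b, hb, hub⟩ := hs ((2 : ℝ) • u) (by rw [norm_smul, hu]; simp)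
    have h2 : ‖T ((2 : ℝ) • u)‖ ≤ ‖T b‖ + ‖T ((2 : ℝ) • u - b)‖ := by
      rw [map_sub]
      exact norm_le_insert' _ _
    have h3 : ‖T ((2 : ℝ) • u - b)‖ ≤ ‖T‖ :=
      (T.le_opNorm _).trans (mul_le_of_le_one_right (norm_nonneg _) hub.le)
    rw [map_smul, norm_smul, Real.norm_ofNat] at h2
    linarith [hmax b hb]
  linarith

end Net

/-! ### Moments of the comparison matrix -/

section ComparisonNorm

open Finset

theorem trace_pow_le_specNorm_pow {r : ℕ} (M : Matrix (Fin r) (Fin r) ℝ) {L : ℕ} (hL : 0 < L) :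
    (M ^ L).trace ≤ r * specNorm M ^ L := by
  have h1 : ∀ a, (M ^ L) a a ≤ specNorm M ^ L := by
    intro a
    have h2 : (M ^ L) a a = inner ℝ (EuclideanSpace.single a (1 : ℝ))
        (Matrix.toEuclideanCLM (n := Fin r) (𝕜 := ℝ) (M ^ L) (EuclideanSpace.single a (1 : ℝ))) := by
      rw [Matrix.inner_toEuclideanCLM]
      simp
    rw [h2]
    refine (real_inner_le_norm _ _).trans ?_
    refine (mul_le_mul_of_nonneg_left (ContinuousLinearMap.le_opNorm _ _) (norm_nonneg _)).trans ?_
    simp only [PiLp.norm_single, norm_one, one_mul, mul_one, map_pow, specNorm]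
    exact norm_pow_le' _ hL
  calc (M ^ L).trace ≤ ∑ _a : Fin r, specNorm M ^ L := sum_le_sum fun a _ => h1 a
    _ = _ := by simp

/-- The maximum over pairs of net points is replaced by a sum of at most `25 ^ r` terms, harmless
because `r = 2 * q` in the application. -/
theorem sum_trace_compMatrix_pow_le {r q : ℕ} (hq : 0 < q) :
    ∑ ω : {e : Sym2 (Fin r) // ¬e.IsDiag} → Fin 3, (compMatrix ω ^ (2 * q)).trace ≤
      3 ^ Fintype.card {e : Sym2 (Fin r) // ¬e.IsDiag} *
        (r * (25 ^ r * (2 * (4 * Real.exp 128 * q) ^ q))) := by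
  obtain ⟨s, hcard, hs2, hs⟩ := exists_net_closedBall_two (EuclideanSpace ℝ (Fin r))
  rw [finrank_euclideanSpace_fin] at hcard
  have hsum : ∀ c ∈ s, ∑ a, c a ^ 2 ≤ 4 := by
    intro c hc
    have h := EuclideanSpace.norm_sq_eq c
    simp only [Real.norm_eq_abs, sq_abs] at h
    rw [← h]
    nlinarith [hs2 c hc, norm_nonneg c]
  have h1 : ∀ M : Matrix (Fin r) (Fin r) ℝ,
      specNorm M ^ (2 * q) ≤ ∑ c ∈ s, ∑ d ∈ s, (c.ofLp ⬝ᵥ M.mulVec d.ofLp) ^ (2 * q) := by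
    intro M
    obtain ⟨c, hc, d, hd, h⟩ :=
      exists_opNorm_le_inner_of_net hs (Matrix.toEuclideanCLM (n := Fin r) (𝕜 := ℝ) M)
    rw [Matrix.inner_toEuclideanCLM] at h
    refine (pow_le_pow_left₀ (norm_nonneg _) h _).trans ?_
    have hnn : ∀ c d : EuclideanSpace ℝ (Fin r),
        0 ≤ (c.ofLp ⬝ᵥ M.mulVec d.ofLp) ^ (2 * q) := fun c d => by
      rw [pow_mul]; positivity
    refine le_trans ?_ (single_le_sum (fun c _ => sum_nonneg fun d _ => hnn c d) hc)
    exact single_le_sum (f := fun d : EuclideanSpace ℝ (Fin r) =>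
      (c.ofLp ⬝ᵥ M.mulVec d.ofLp) ^ (2 * q)) (fun d _ => hnn c d) hd
  set N : ℝ := 3 ^ Fintype.card {e : Sym2 (Fin r) // ¬e.IsDiag} with hN
  set B : ℝ := 2 * (4 * Real.exp 128 * q) ^ q with hB
  have hB0 : 0 ≤ B := by positivity
  calc ∑ ω : {e : Sym2 (Fin r) // ¬e.IsDiag} → Fin 3, (compMatrix ω ^ (2 * q)).trace
      ≤ ∑ ω : {e : Sym2 (Fin r) // ¬e.IsDiag} → Fin 3,
          r * ∑ c ∈ s, ∑ d ∈ s, (c.ofLp ⬝ᵥ (compMatrix ω).mulVec d.ofLp) ^ (2 * q) := by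
        refine sum_le_sum fun ω _ => (trace_pow_le_specNorm_pow _ (by omega)).trans ?_
        gcongr
        exact h1 _
    _ = r * ∑ c ∈ s, ∑ d ∈ s, ∑ ω : {e : Sym2 (Fin r) // ¬e.IsDiag} → Fin 3,
          (c.ofLp ⬝ᵥ (compMatrix ω).mulVec d.ofLp) ^ (2 * q) := by
        rw [← mul_sum, sum_comm]
        congr 1
        exact sum_congr rfl fun c _ => sum_comm
    _ ≤ r * ∑ c ∈ s, ∑ d ∈ s, N * B := by
        gcongr with c hc d hd
        exact sum_dotProduct_compMatrix_pow_le _ _ (hsum c hc) (hsum d hd) q hq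
    _ = r * ((s.card : ℝ) * s.card * (N * B)) := by
        simp only [sum_const, nsmul_eq_mul]
        ring
    _ ≤ r * ((5 : ℝ) ^ r * 5 ^ r * (N * B)) := by
        have : (s.card : ℝ) ≤ 5 ^ r := by exact_mod_cast hcard
        gcongr
    _ = N * (r * (25 ^ r * B)) := by
        rw [← mul_pow]
        norm_num
        ring

end ComparisonNorm
-- Spectral norm and trace
section SpectralNorm

open Finset

theorem specNorm_sq_le_sum_sq {n : ℕ} (M : Matrix (Fin n) (Fin n) ℝ) :
    specNorm M ^ 2 ≤ ∑ i, ∑ j, M i j ^ 2 := by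
  have hnn : 0 ≤ ∑ i, ∑ j, M i j ^ 2 := sum_nonneg fun i _ => sum_nonneg fun j _ => sq_nonneg _
  refine (Real.le_sqrt (norm_nonneg _) hnn).1 ?_
  refine ContinuousLinearMap.opNorm_le_bound _ (Real.sqrt_nonneg _) fun x => ?_
  rw [EuclideanSpace.norm_eq, EuclideanSpace.norm_eq x, ← Real.sqrt_mul hnn]
  refine Real.sqrt_le_sqrt ?_
  rw [sum_mul]
  refine sum_le_sum fun i _ => ?_
  simp only [Matrix.ofLp_toEuclideanCLM, Matrix.mulVec, dotProduct, Real.norm_eq_abs, sq_abs]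
  exact sum_mul_sq_le_sq_mul_sq _ _ _

/-- Iterating the C⋆-identity gives `‖M ^ 2 ^ j‖ = ‖M‖ ^ 2 ^ j`, and the trace is the squared
Frobenius norm of `M ^ 2 ^ j`. This is why `q` is later a power of two. -/
theorem specNorm_pow_le_trace_pow {n : ℕ} (M : Matrix (Fin n) (Fin n) ℝ)
    (hM : M.transpose = M) (j : ℕ) :
    specNorm M ^ (2 * 2 ^ j) ≤ (M ^ (2 * 2 ^ j)).trace := by
  have hsa : IsSelfAdjoint (Matrix.toEuclideanCLM (n := Fin n) (𝕜 := ℝ) M) := by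
    rw [IsSelfAdjoint, ← map_star, Matrix.star_eq_conjTranspose,
      Matrix.conjTranspose_eq_transpose_of_trivial, hM]
  have h1 : specNorm (M ^ 2 ^ j) = specNorm M ^ 2 ^ j := by
    rw [specNorm, specNorm, map_pow, hsa.norm_pow_two_pow]
  rw [mul_comm, pow_mul, ← h1, pow_mul]
  refine (specNorm_sq_le_sum_sq _).trans (le_of_eq ?_)
  have hT : (M ^ 2 ^ j).transpose = M ^ 2 ^ j := by rw [Matrix.transpose_pow, hM]
  rw [pow_two (M ^ 2 ^ j), Matrix.trace]
  simp only [Matrix.diag_apply, Matrix.mul_apply]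
  refine sum_congr rfl fun i _ => sum_congr rfl fun k _ => ?_
  rw [sq]
  conv_lhs => rw [← hT]
  conv_rhs => rw [← hT]
  simp only [Matrix.transpose_apply]
  rw [← Matrix.transpose_apply (M ^ 2 ^ j) k i, hT]

theorem specNorm_add_le {n : ℕ} (M N : Matrix (Fin n) (Fin n) ℝ) :
    specNorm (M + N) ≤ specNorm M + specNorm N := by
  rw [specNorm, map_add]
  exact norm_add_le _ _

end SpectralNorm

/-! ### Moments of a centred random matrix -/

section Moments

open Finset

variable {Ω : Type*} [MeasurableSpace Ω] {μ : Measure Ω} [IsProbabilityMeasure μ]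
  {V : Type*} [Fintype V] [DecidableEq V]

theorem abs_integral_pow_le_of_two_le {f : Ω → ℝ} (hf : Measurable f) (hb : ∀ ω, |f ω| ≤ 1)
    {k : ℕ} (hk : 2 ≤ k) : |∫ ω, f ω ^ k ∂μ| ≤ ∫ ω, f ω ^ 2 ∂μ := by
  have hint : ∀ k, Integrable (fun ω => f ω ^ k) μ := fun k =>
    Integrable.of_bound (hf.pow_const k).aestronglyMeasurable 1 (ae_of_all _ fun ω => by
      rw [norm_pow, Real.norm_eq_abs]
      exact pow_le_one₀ (abs_nonneg _) (hb ω))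
  refine abs_integral_le_integral_abs.trans (integral_mono (hint k).abs (hint 2) fun ω => ?_)
  change |f ω ^ k| ≤ f ω ^ 2
  rw [abs_pow, ← sq_abs (f ω)]
  exact pow_le_pow_of_le_one (abs_nonneg _) (hb ω) hk

theorem GoodWalk.prod_edgeSet_eq {L : ℕ} {w : Fin (L + 1) → V} (hw : GoodWalk w)
    (p : Sym2 V → ℝ) :
    ∏ e ∈ edgeSet w, p e =
      ∏ e : {e : Sym2 V // ¬e.IsDiag}, if edgeMult w e.1 = 0 then 1 else p e.1 := by
  rw [← prod_subtype (univ.filter fun e : Sym2 V => ¬e.IsDiag) (by simp)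
    fun e => if edgeMult w e = 0 then 1 else p e]
  refine prod_subset_one_on_sdiff ?_ ?_ ?_
  · intro e he
    obtain ⟨i, -, rfl⟩ := mem_image.1 he
    simpa [stepEdge] using hw.2.1 i
  · intro e he
    have := (mem_sdiff.1 he).2
    rw [mem_edgeSet_iff, not_not] at this
    rw [if_pos this]
  · intro e he
    rw [if_neg ((mem_edgeSet_iff w e).1 he)]

-- An edge used once contributes mean zero; an edge used more often contributes at most its
-- variance, since entries have modulus at most 1.
open scoped Classical in
theorem integral_trace_edgeMatrix_pow_le (x : {e : Sym2 V // ¬e.IsDiag} → Ω → ℝ)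
    (hx : ∀ e, Measurable (x e)) (hb : ∀ e ω, |x e ω| ≤ 1) (hindep : iIndepFun x μ)
    (h0 : ∀ e, ∫ ω, x e ω ∂μ = 0) (p : Sym2 V → ℝ)
    (hp : ∀ e, ∫ ω, x e ω ^ 2 ∂μ ≤ p e.1) (L : ℕ) :
    ∫ ω, (edgeMatrix (fun e => x e ω) ^ L).trace ∂μ ≤
      ∑ w : Fin (L + 1) → V with GoodWalk w, ∏ e ∈ edgeSet w, p e := by
  have hmeas : ∀ w : Fin (L + 1) → V, Measurable fun ω => ∏ e, x e ω ^ edgeMult w e.1 :=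
    fun w => Finset.measurable_fun_prod _ fun e _ => (hx e).pow_const _
  have hbd : ∀ (w : Fin (L + 1) → V) ω, ‖∏ e, x e ω ^ edgeMult w e.1‖ ≤ 1 := by
    intro w ω
    rw [norm_prod]
    refine prod_le_one (fun _ _ => norm_nonneg _) fun e _ => ?_
    rw [norm_pow, Real.norm_eq_abs]
    exact pow_le_one₀ (abs_nonneg _) (hb e ω)
  have hint : ∀ w : Fin (L + 1) → V, Integrable (fun ω => ∏ e, x e ω ^ edgeMult w e.1) μ :=
    fun w => Integrable.of_bound (hmeas w).aestronglyMeasurable 1 (ae_of_all _ (hbd w))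
  have hval : ∀ w : Fin (L + 1) → V, ∫ ω, ∏ e, x e ω ^ edgeMult w e.1 ∂μ =
      ∏ e, ∫ ω, x e ω ^ edgeMult w e.1 ∂μ := by
    intro w
    have hpow : ∀ k : ℕ, Measurable fun y : ℝ => y ^ k := fun k => measurable_id.pow_const k
    exact (hindep.comp (fun e y => y ^ edgeMult w e.1)
      fun e => hpow _).integral_fun_prod_eq_prod_integral
        fun e => ((hx e).pow_const _).aestronglyMeasurable
  have htr : ∀ ω, (edgeMatrix (fun e => x e ω) ^ L).trace = ∑ w : Fin (L + 1) → V,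
      if w 0 = w (Fin.last L) ∧ ∀ i : Fin L, w i.castSucc ≠ w i.succ then
        ∏ e, x e ω ^ edgeMult w e.1 else 0 := by
    intro ω
    rw [trace_pow_eq_sum_walk]
    simp only [prod_edgeMatrix, ite_and]
  simp only [htr]
  have hint' : ∀ w : Fin (L + 1) → V, Integrable (fun ω =>
      if w 0 = w (Fin.last L) ∧ ∀ i : Fin L, w i.castSucc ≠ w i.succ then
        ∏ e, x e ω ^ edgeMult w e.1 else 0) μ := by
    intro w
    by_cases h : w 0 = w (Fin.last L) ∧ ∀ i : Fin L, w i.castSucc ≠ w i.succ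
    · simp only [if_pos h]
      exact hint w
    · simp only [if_neg h]
      exact integrable_zero _ _ _
  rw [integral_finsetSum _ fun w _ => hint' w, sum_filter]
  refine sum_le_sum fun w _ => ?_
  by_cases hw : w 0 = w (Fin.last L) ∧ ∀ i : Fin L, w i.castSucc ≠ w i.succ
  swap
  · rw [if_neg fun h : GoodWalk w => hw ⟨h.1, h.2.1⟩]
    simp [hw]
  simp only [if_pos hw, hval]
  split_ifs with hg
  · rw [hg.prod_edgeSet_eq]
    refine (le_abs_self _).trans ?_
    rw [abs_prod]
    refine prod_le_prod (fun _ _ => abs_nonneg _) fun e _ => ?_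
    split_ifs with hk
    · simp [hk]
    · have h1 := hg.2.2 e.1
      exact (abs_integral_pow_le_of_two_le (hx e) (hb e) (by omega)).trans (hp e)
  · have : ∃ e, edgeMult w e = 1 := by
      by_contra! h
      exact hg ⟨hw.1, hw.2, h⟩
    obtain ⟨e, he⟩ := this
    have hmem : e ∈ edgeSet w := by rw [mem_edgeSet_iff]; omega
    obtain ⟨i, -, rfl⟩ := mem_image.1 hmem
    have hd : ¬(stepEdge w i).IsDiag := by simpa [stepEdge] using hw.2 i
    refine le_of_eq (prod_eq_zero (mem_univ ⟨stepEdge w i, hd⟩) ?_)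
    simp only [he, pow_one, h0]

/-- The moment bound for a symmetric random matrix with independent centred entries of modulus at
most `1`. -/
theorem integral_trace_edgeMatrix_pow_le_of_sum_le (x : {e : Sym2 V // ¬e.IsDiag} → Ω → ℝ)
    (hx : ∀ e, Measurable (x e)) (hb : ∀ e ω, |x e ω| ≤ 1) (hindep : iIndepFun x μ)
    (h0 : ∀ e, ∫ ω, x e ω ∂μ = 0) (p : Sym2 V → ℝ) (hp0 : ∀ e, 0 ≤ p e) (hp1 : ∀ e, p e ≤ 1)
    (hp : ∀ e, ∫ ω, x e ω ^ 2 ∂μ ≤ p e.1) (D q : ℕ) (hD : 0 < D)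
    (hpD : ∀ b, ∑ a, p s(a, b) ≤ D) (hDq : D ≤ q) :
    ∫ ω, (edgeMatrix (fun e => x e ω) ^ (2 * q)).trace ∂μ ≤
      Fintype.card V * (40000 * Real.exp 128 * q) ^ q := by
  classical
  have hq : 0 < q := by omega
  refine (integral_trace_edgeMatrix_pow_le x hx hb hindep h0 p hp (2 * q)).trans ?_
  refine (sum_goodWalk_prod_edgeSet_le (U := Fin (2 * q)) p hp0 hp1 D q hD hpD
    (by rw [Fintype.card_fin]; omega)).trans ?_
  gcongr
  have h1 := (card_goodWalk_le_sum_trace (V := Fin (2 * q)) (2 * q)).trans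
    (sum_trace_compMatrix_pow_le hq)
  refine (le_of_mul_le_mul_left h1 (by positivity)).trans ?_
  have h2 : (q : ℝ) ≤ 2 ^ q := by exact_mod_cast Nat.lt_two_pow_self.le
  have h4 : (4 : ℝ) ≤ 8 ^ q := by
    calc (4 : ℝ) ≤ 8 ^ 1 := by norm_num
      _ ≤ 8 ^ q := pow_le_pow_right₀ (by norm_num) hq
  have h5 : (40000 * Real.exp 128 * q) ^ q =
      -- Here `40000 = 8 * 2 * 625 * 4`; the first two factors absorb the prefactor `4 * q`, and
      -- `625 = 25 ^ 2` comes from the net in dimension `2 * q`.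
      8 ^ q * 2 ^ q * (625 ^ q * (4 * Real.exp 128 * q) ^ q) := by
    simp only [← mul_pow]
    congr 1
    ring
  rw [h5, pow_mul]
  calc ((2 * q : ℕ) : ℝ) * ((25 ^ 2) ^ q * (2 * (4 * Real.exp 128 * q) ^ q))
      = 4 * q * (625 ^ q * (4 * Real.exp 128 * q) ^ q) := by
        push_cast
        norm_num
        ring
    _ ≤ _ := by gcongr

end Moments
-- Tail bound by Markov's inequality
section TailBound

variable {Ω : Type*} [MeasurableSpace Ω] {μ : Measure Ω} [IsProbabilityMeasure μ]

/-- A tail bound for the trace of a power of a random matrix with independent centred entries. -/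
theorem measureReal_le_trace_edgeMatrix_pow_le {n : ℕ}
    (x : {e : Sym2 (Fin n) // ¬e.IsDiag} → Ω → ℝ)
    (hx : ∀ e, Measurable (x e)) (hb : ∀ e ω, |x e ω| ≤ 1) (hindep : iIndepFun x μ)
    (h0 : ∀ e, ∫ ω, x e ω ∂μ = 0) (p : Sym2 (Fin n) → ℝ) (hp0 : ∀ e, 0 ≤ p e)
    (hp1 : ∀ e, p e ≤ 1) (hp : ∀ e, ∫ ω, x e ω ^ 2 ∂μ ≤ p e.1) (D j : ℕ) (hD : 0 < D)
    (hpD : ∀ b, ∑ a, p s(a, b) ≤ D) (hDq : D ≤ 2 ^ j) :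
    μ.real {ω | √(40000 * Real.exp 129 * (2 ^ j : ℕ)) < specNorm (edgeMatrix fun e => x e ω)} ≤
      n * Real.exp (-(2 ^ j : ℕ)) := by
  set q := 2 ^ j with hq
  have hq0 : 0 < q := by positivity
  have hq0' : (0 : ℝ) < q := by exact_mod_cast hq0
  have hnorm : ∀ ω, specNorm (edgeMatrix fun e => x e ω) ^ (2 * q) ≤
      (edgeMatrix (fun e => x e ω) ^ (2 * q)).trace := fun ω =>
    specNorm_pow_le_trace_pow _ (edgeMatrix_transpose _) j
  have hnn : ∀ ω, 0 ≤ (edgeMatrix (fun e => x e ω) ^ (2 * q)).trace := fun ω =>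
    (pow_nonneg (norm_nonneg _) _).trans (hnorm ω)
  have hentry : ∀ a b, Measurable fun ω => edgeMatrix (fun e => x e ω) a b := by
    intro a b
    by_cases h : a = b
    · simp [edgeMatrix, h]
    · simpa [edgeMatrix, h] using hx ⟨s(a, b), h⟩
  have hentry_le : ∀ a b ω, |edgeMatrix (fun e => x e ω) a b| ≤ 1 := by
    intro a b ω
    by_cases h : a = b
    · simp [edgeMatrix, h]
    · simpa [edgeMatrix, h] using hb ⟨s(a, b), h⟩ ω
  have hint : Integrable (fun ω => (edgeMatrix (fun e => x e ω) ^ (2 * q)).trace) μ := by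
    simp only [trace_pow_eq_sum_walk]
    refine integrable_finsetSum _ fun w _ => ?_
    by_cases h : w 0 = w (Fin.last (2 * q))
    · simp only [if_pos h]
      refine Integrable.of_bound
        (Finset.measurable_fun_prod _ fun i _ => hentry _ _).aestronglyMeasurable 1
        (ae_of_all _ fun ω => ?_)
      rw [norm_prod]
      exact Finset.prod_le_one (fun _ _ => norm_nonneg _) fun i _ => hentry_le _ _ ω
    · simp only [if_neg h]
      exact integrable_zero _ _ _
  -- Raising the exponent from 128 to 129 gains exactly `exp (-q)` in Markov's inequality.
  set T : ℝ := (40000 * Real.exp 129 * q) ^ q with hT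
  have hT0 : 0 < T := by positivity
  have hmarkov := mul_meas_ge_le_integral_of_nonneg (ae_of_all _ hnn) hint T
  have hmom := integral_trace_edgeMatrix_pow_le_of_sum_le x hx hb hindep h0 p hp0 hp1 hp D q hD
    hpD hDq
  rw [Fintype.card_fin] at hmom
  have hTe : (40000 * Real.exp 128 * q) ^ q = T * Real.exp (-q) := by
    have h1 : Real.exp (-(q : ℝ)) = Real.exp (-1) ^ q := by
      rw [← Real.exp_nat_mul]
      ring_nf
    rw [hT, h1, ← mul_pow]
    congr 1
    have h2 : Real.exp 128 = Real.exp 129 * Real.exp (-1) := by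
      rw [← Real.exp_add]
      norm_num
    rw [h2]
    ring
  have hle : μ.real {ω | T ≤ (edgeMatrix (fun e => x e ω) ^ (2 * q)).trace} ≤
      n * Real.exp (-q) := by
    refine le_of_mul_le_mul_left (hmarkov.trans (hmom.trans (le_of_eq ?_))) hT0
    rw [hTe]
    ring
  refine (measureReal_mono fun ω hω => ?_).trans hle
  refine le_trans ?_ (hnorm ω)
  rw [pow_mul]
  refine pow_le_pow_left₀ (by positivity) ?_ _
  exact (Real.sqrt_le_left (norm_nonneg _)).1 (le_of_lt hω)

end TailBound

/-! ### Application to the block model -/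

section BlockModel

variable {Ω : Type*} [MeasurableSpace Ω] {μ : Measure Ω}

theorem integral_of_zero_or_one {f : Ω → ℝ} (hf : Measurable f) (h01 : ∀ ω, f ω = 0 ∨ f ω = 1)
    {b : ℝ} (hb : 0 ≤ b) (h : μ {ω | f ω = 1} = ENNReal.ofReal b) : ∫ ω, f ω ∂μ = b := by
  have h1 : f = Set.indicator {ω | f ω = 1} 1 := by
    ext ω
    rcases h01 ω with h | h <;> simp [Set.indicator, h]
  have h2 : MeasurableSet {ω | f ω = 1} := hf (measurableSet_singleton 1)
  rw [h1, integral_indicator_one h2, measureReal_def, h, ENNReal.toReal_ofReal hb]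

theorem integral_sub_of_zero_or_one [IsProbabilityMeasure μ] {f : Ω → ℝ} (hf : Measurable f)
    (h01 : ∀ ω, f ω = 0 ∨ f ω = 1) {b : ℝ} (hb : 0 ≤ b)
    (h : μ {ω | f ω = 1} = ENNReal.ofReal b) :
    ∫ ω, (f ω - b) ∂μ = 0 ∧ ∫ ω, (f ω - b) ^ 2 ∂μ ≤ b := by
  have hint : Integrable f μ := Integrable.of_bound hf.aestronglyMeasurable 1
    (ae_of_all _ fun ω => by rcases h01 ω with h | h <;> simp [h])
  have hE := integral_of_zero_or_one hf h01 hb h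
  constructor
  · rw [integral_sub hint (integrable_const _), hE]
    simp
  · have h2 : ∀ ω, (f ω - b) ^ 2 = (1 - 2 * b) * f ω + b ^ 2 := fun ω => by
      rcases h01 ω with h | h <;> rw [h] <;> ring
    simp only [h2]
    rw [integral_add (hint.const_mul _) (integrable_const _), integral_const_mul, hE]
    simp
    nlinarith [sq_nonneg b]

theorem probMatrix_apply {n K : ℕ} (z : Fin n → Fin K) (B : Matrix (Fin K) (Fin K) ℝ)
    (i j : Fin n) : probMatrix z B i j = B (z i) (z j) := by
  simp [probMatrix, membership, Matrix.mul_apply]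

theorem baseConn_apply (K : ℕ) (τ : ℝ) (k l : Fin K) :
    baseConn K τ k l = if k = l then 1 else τ := by
  by_cases h : k = l <;> simp [baseConn, Matrix.vecMulVec_apply, h]

theorem sum_comp_eq_sum_commSize {n K : ℕ} (z : Fin n → Fin K) (g : Fin K → ℝ) :
    ∑ i, g (z i) = ∑ l, (commSize z l : ℝ) * g l := by
  rw [← Finset.sum_fiberwise' Finset.univ z g]
  simp [commSize]

theorem sum_commSize {n K : ℕ} (z : Fin n → Fin K) : ∑ k, commSize z k = n := by
  have := sum_comp_eq_sum_commSize z fun _ => 1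
  simp only [Finset.sum_const, mul_one, Finset.card_univ, Fintype.card_fin, nsmul_eq_mul] at this
  exact_mod_cast this.symm

section WeightedSizes

variable {n K nmin nmax : ℕ} {z : Fin n → Fin K} {τ : ℝ}

theorem sum_commSize_mul_mem_weightedSizes
    (hz : ∀ k, nmin ≤ commSize z k ∧ commSize z k ≤ nmax) (B₀ : Matrix (Fin K) (Fin K) ℝ)
    (k : Fin K) : ∑ l, (commSize z l : ℝ) * B₀ k l ∈ weightedSizes n nmin nmax B₀ :=
  ⟨commSize z, ⟨hz, sum_commSize z⟩, k, rfl⟩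

theorem one_le_of_mem_weightedSizes (hτ : 0 ≤ τ) (hmin : 0 < nmin) {x : ℝ}
    (hx : x ∈ weightedSizes n nmin nmax (baseConn K τ)) : 1 ≤ x := by
  obtain ⟨m, hm, k, rfl⟩ := hx
  have h1 : (1 : ℝ) ≤ m k * baseConn K τ k k := by
    rw [baseConn_apply, if_pos rfl, mul_one]
    exact_mod_cast hmin.trans_le (hm.1 k).1
  refine h1.trans (Finset.single_le_sum (f := fun l => (m l : ℝ) * baseConn K τ k l)
    (fun l _ => mul_nonneg (Nat.cast_nonneg _) ?_) (Finset.mem_univ k))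
  rw [baseConn_apply]
  split_ifs <;> simp [hτ]

theorem one_le_nBarMin (hτ : 0 ≤ τ) (hmin : 0 < nmin)
    (hz : ∀ k, nmin ≤ commSize z k ∧ commSize z k ≤ nmax) (k : Fin K) :
    1 ≤ nBarMin n nmin nmax (baseConn K τ) :=
  le_csInf ⟨_, sum_commSize_mul_mem_weightedSizes hz _ k⟩
    fun _ hx => one_le_of_mem_weightedSizes hτ hmin hx

theorem sum_commSize_mul_le_nBarMax (hz : ∀ k, nmin ≤ commSize z k ∧ commSize z k ≤ nmax)
    (B₀ : Matrix (Fin K) (Fin K) ℝ) (k : Fin K) :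
    ∑ l, (commSize z l : ℝ) * B₀ k l ≤ nBarMax n nmin nmax B₀ :=
  le_csSup (weightedSizes_finite n nmin nmax B₀).bddAbove
    (sum_commSize_mul_mem_weightedSizes hz B₀ k)

theorem nBarMin_le_nBarMax (hz : ∀ k, nmin ≤ commSize z k ∧ commSize z k ≤ nmax)
    (B₀ : Matrix (Fin K) (Fin K) ℝ) (k : Fin K) :
    nBarMin n nmin nmax B₀ ≤ nBarMax n nmin nmax B₀ :=
  (csInf_le (weightedSizes_finite n nmin nmax B₀).bddBelow
    (sum_commSize_mul_mem_weightedSizes hz B₀ k)).trans (sum_commSize_mul_le_nBarMax hz B₀ k)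

end WeightedSizes

theorem inf_lt_sup_of_not_isDiag {V : Type*} [LinearOrder V] {e : Sym2 V} (he : ¬e.IsDiag) :
    e.inf < e.sup := by
  induction e with | _ a b
  simpa [eq_comm] using he

theorem apply_inf_sup {V R : Type*} [LinearOrder V] {f : V → V → R} (hf : ∀ a b, f b a = f a b)
    (a b : V) : f (s(a, b) : Sym2 V).inf (s(a, b) : Sym2 V).sup = f a b := by
  rcases le_total a b with h | h
  · simp [h]
  · simp [h, hf]

/-- The off-diagonal part of the centred adjacency matrix has small norm, with large
probability. -/
theorem IsSBM.measureReal_offDiag_le [IsProbabilityMeasure μ] {n K : ℕ}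
    {z : Fin n → Fin K} {B : Matrix (Fin K) (Fin K) ℝ} {A : Ω → Matrix (Fin n) (Fin n) ℝ}
    (hA : IsSBM μ z B A) (hB : ∀ k l, B l k = B k l) (hB0 : ∀ k l, 0 ≤ B k l)
    (hB1 : ∀ k l, B k l ≤ 1) (D j : ℕ)
    (hD : 0 < D) (hBD : ∀ k, ∑ i, B k (z i) ≤ D) (hDq : D ≤ 2 ^ j) :
    μ.real {ω | √(40000 * Real.exp 129 * (2 ^ j : ℕ)) <
        specNorm (Matrix.of fun a b => if a = b then 0 else A ω a b - B (z a) (z b))} ≤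
      n * Real.exp (-(2 ^ j : ℕ)) := by
  -- Each unordered edge is read at its increasing pair, where independence is assumed.
  let x : {e : Sym2 (Fin n) // ¬e.IsDiag} → Ω → ℝ := fun e ω =>
    A ω e.1.inf e.1.sup - B (z e.1.inf) (z e.1.sup)
  have hmat : ∀ ω, (edgeMatrix fun e => x e ω) =
      Matrix.of fun a b => if a = b then 0 else A ω a b - B (z a) (z b) := by
    intro ω
    ext a b
    by_cases h : a = b
    · simp [edgeMatrix, h]
    · simp only [edgeMatrix, x, Matrix.of_apply, h, dif_neg, not_false_eq_true, if_false]
      exact apply_inf_sup (f := fun a b => A ω a b - B (z a) (z b))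
        (fun a b => by rw [hA.symmetric, hB]) a b
  have hx := fun e : {e : Sym2 (Fin n) // ¬e.IsDiag} =>
    integral_sub_of_zero_or_one (hA.measurable_entry e.1.inf e.1.sup)
      (fun ω => hA.zero_or_one ω _ _) (hB0 (z e.1.inf) (z e.1.sup))
      (hA.prob_one _ _ (inf_lt_sup_of_not_isDiag e.2))
  have hindep : iIndepFun x μ := by
    let g : {e : Sym2 (Fin n) // ¬e.IsDiag} → {e : Fin n × Fin n // e.1 < e.2} := fun e =>
      ⟨(e.1.inf, e.1.sup), inf_lt_sup_of_not_isDiag e.2⟩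
    have hg : g.Injective := by
      intro e f hef
      have h := congrArg Subtype.val hef
      exact Subtype.ext (Sym2.inf_eq_inf_and_sup_eq_sup.1
        ⟨congrArg Prod.fst h, congrArg Prod.snd h⟩)
    exact (hA.indep.precomp hg).comp (fun e y => y - B (z e.1.inf) (z e.1.sup))
      fun e => measurable_id.sub_const _
  simp only [← hmat]
  refine measureReal_le_trace_edgeMatrix_pow_le x
    (fun e => (hA.measurable_entry _ _).sub_const _) (fun e ω => ?_) hindep (fun e => (hx e).1)
    (fun e => B (z e.inf) (z e.sup)) (fun e => hB0 _ _) (fun e => hB1 _ _) (fun e => (hx e).2)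
    D j hD (fun b => ?_) hDq
  · have h1 := hB0 (z e.1.inf) (z e.1.sup)
    have h2 := hB1 (z e.1.inf) (z e.1.sup)
    simp only [x]
    rw [abs_le]
    rcases hA.zero_or_one ω e.1.inf e.1.sup with h | h <;> rw [h] <;> constructor <;> linarith
  · refine le_trans (le_of_eq (Finset.sum_congr rfl fun a _ => ?_)) (hBD (z b))
    rw [apply_inf_sup (f := fun a b => B (z a) (z b)) (fun a b => hB _ _), hB]

end BlockModel

theorem specNorm_smul_one_le {n : ℕ} {a : ℝ} (ha : 0 ≤ a) :
    specNorm (a • (1 : Matrix (Fin n) (Fin n) ℝ)) ≤ a := by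
  rw [specNorm, map_smul, map_one, norm_smul, Real.norm_of_nonneg ha]
  exact mul_le_of_le_one_right ha ContinuousLinearMap.norm_id_le

theorem specNorm_neg {n : ℕ} (M : Matrix (Fin n) (Fin n) ℝ) : specNorm (-M) = specNorm M := by
  rw [specNorm, map_neg, norm_neg, specNorm]

theorem commSize_le {n K : ℕ} (z : Fin n → Fin K) (k : Fin K) : commSize z k ≤ n :=
  (Finset.card_filter_le _ _).trans (by simp)

/-- A single nonempty community suffices, its size being at most `n`; a failure probability `n ^
(-ν)` is therefore enough. -/
theorem rpow_neg_le_sum_commSize_rpow_neg {n K : ℕ} (hn : 0 < n) (z : Fin n → Fin K) {ν : ℝ}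
    (hν : 0 < ν) : (n : ℝ) ^ (-ν) ≤ ∑ k, (commSize z k : ℝ) ^ (-ν) := by
  let i : Fin n := ⟨0, hn⟩
  have hpos : 0 < commSize z (z i) := Finset.card_pos.2 ⟨i, by simp⟩
  refine le_trans ?_ (Finset.single_le_sum (f := fun k => (commSize z k : ℝ) ^ (-ν))
    (fun k _ => Real.rpow_nonneg (Nat.cast_nonneg _) _) (Finset.mem_univ (z i)))
  exact Real.rpow_le_rpow_of_nonpos (by exact_mod_cast hpos) (by exact_mod_cast commSize_le z _)
    (by linarith)

theorem exists_two_pow_between {m : ℕ} (hm : 0 < m) : ∃ j, m ≤ 2 ^ j ∧ 2 ^ j ≤ 2 * m := by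
  obtain ⟨j, h1, h2⟩ := exists_nat_pow_near (x := m) (y := 2) hm (by norm_num)
  exact ⟨j + 1, h2.le, by rw [pow_succ]; omega⟩

theorem natCast_mul_exp_neg_le {n : ℕ} (hn : 0 < n) {ν q : ℝ} (hq : (ν + 1) * Real.log n ≤ q) :
    n * Real.exp (-q) ≤ (n : ℝ) ^ (-ν) := by
  have hn' : (0 : ℝ) < n := by exact_mod_cast hn
  rw [Real.rpow_def_of_pos hn']
  nth_rewrite 1 [← Real.exp_log hn']
  rw [← Real.exp_add]
  exact Real.exp_le_exp.2 (by linarith)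

/-- Subadditivity alone is used, so no measurability of the norm event is needed. -/
theorem one_le_measureReal_add_compl {Ω : Type*} [MeasurableSpace Ω] (μ : Measure Ω)
    [IsProbabilityMeasure μ] (s : Set Ω) : 1 ≤ μ.real s + μ.real sᶜ := by
  rw [← probReal_univ (μ := μ), ← Set.union_compl_self s]
  exact measureReal_union_le _ _

/-! ### Choice of the moment order and of the constant -/

section BlockBound

variable {Ω : Type*} [MeasurableSpace Ω] {μ : Measure Ω} [IsProbabilityMeasure μ]
  {n K nmin nmax : ℕ} {τ α : ℝ} {z : Fin n → Fin K} {A : Ω → Matrix (Fin n) (Fin n) ℝ}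

theorem IsSBM.measureReal_specNorm_sub_gt_le (hA : IsSBM μ z (α • baseConn K τ) A) {c ν : ℝ}
    (hc : 0 < c) (hν : 0 < ν) (hn : 2 ≤ n) (hτ0 : 0 ≤ τ) (hτ1 : τ ≤ 1) (hα0 : 0 < α)
    (hα1 : α < 1) (hmin : 0 < nmin)
    (hz : ∀ k, nmin ≤ commSize z k ∧ commSize z k ≤ nmax)
    (hα : c * (Real.log n / nBarMin n nmin nmax (baseConn K τ)) ≤ α) :
    μ.real {ω | (√(40000 * Real.exp 129 * (2 * (1 + (ν + 1) / c + 2 / (c * Real.log 2)))) + 1) *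
        √(nBarMax n nmin nmax (baseConn K τ) * α) <
        specNorm (A ω - probMatrix z (α • baseConn K τ))} ≤ (n : ℝ) ^ (-ν) := by
  have hk : Fin K := z ⟨0, by omega⟩
  set d := nBarMax n nmin nmax (baseConn K τ) * α with hd
  have hmin1 := one_le_nBarMin hτ0 hmin hz hk
  have hmax1 := hmin1.trans (nBarMin_le_nBarMax hz _ hk)
  have hlog2 : 0 < Real.log 2 := Real.log_pos (by norm_num)
  have hlog : Real.log 2 ≤ Real.log n :=
    Real.log_le_log (by norm_num) (by exact_mod_cast hn)
  have hcd : c * Real.log n ≤ d := by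
    have h1 : c * Real.log n = c * (Real.log n / nBarMin n nmin nmax (baseConn K τ)) *
        nBarMin n nmin nmax (baseConn K τ) := by
      field_simp
    rw [h1, hd, mul_comm _ α]
    exact mul_le_mul hα (nBarMin_le_nBarMax hz _ hk) (by linarith) hα0.le
  have hd0 : 0 < d := by positivity
  set D := ⌈d⌉₊ with hD
  set m := D + ⌈(ν + 1) * Real.log n⌉₊ with hm
  have hDpos : 0 < D := Nat.ceil_pos.2 hd0
  obtain ⟨j, hj1, hj2⟩ := exists_two_pow_between (m := m) (by omega)
  have hνlog : 0 ≤ (ν + 1) * Real.log n := mul_nonneg (by linarith) (by linarith)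
  have hq1 : (ν + 1) * Real.log n ≤ (2 ^ j : ℕ) := by
    refine (Nat.le_ceil _).trans ?_
    exact_mod_cast (Nat.le_add_left _ _).trans hj1
  have hq2 : ((2 ^ j : ℕ) : ℝ) ≤ 2 * (1 + (ν + 1) / c + 2 / (c * Real.log 2)) * d := by
    have h1 : ((2 ^ j : ℕ) : ℝ) ≤ 2 * (D + ⌈(ν + 1) * Real.log n⌉₊) := by
      rw [hm] at hj2
      exact_mod_cast hj2
    have h2 : (D : ℝ) ≤ d + 1 := (Nat.ceil_lt_add_one hd0.le).le
    have h3 := (Nat.ceil_lt_add_one hνlog).le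
    have h4 : (ν + 1) * Real.log n ≤ (ν + 1) / c * d := by
      rw [div_mul_eq_mul_div, le_div_iff₀ hc]
      nlinarith
    -- The two ceilings cost at most 2, absorbed because `d ≥ c * log n ≥ c * log 2`; this needs `n
    -- ≥ 2`.
    have h5 : 2 ≤ 2 / (c * Real.log 2) * d := by
      rw [div_mul_eq_mul_div, le_div_iff₀ (by positivity)]
      nlinarith
    nlinarith
  have hBnn : ∀ k l, 0 ≤ baseConn K τ k l := fun k l => by
    rw [baseConn_apply]; split_ifs <;> linarith
  have hBle : ∀ k l, baseConn K τ k l ≤ 1 := fun k l => by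
    rw [baseConn_apply]; split_ifs <;> linarith
  have hmain := hA.measureReal_offDiag_le
    (fun k l => by simp [baseConn_apply, eq_comm])
    (fun k l => mul_nonneg hα0.le (hBnn k l))
    (fun k l => mul_le_one₀ hα1.le (hBnn k l) (hBle k l)) D j hDpos
    (fun k => by
      rw [sum_comp_eq_sum_commSize z ((α • baseConn K τ) k)]
      refine le_trans ?_ (Nat.le_ceil d)
      calc ∑ l, (commSize z l : ℝ) * (α • baseConn K τ) k l
          = (∑ l, (commSize z l : ℝ) * baseConn K τ k l) * α := by
            rw [Finset.sum_mul]
            refine Finset.sum_congr rfl fun l _ => ?_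
            rw [Matrix.smul_apply, smul_eq_mul]
            ring
        _ ≤ d := mul_le_mul_of_nonneg_right (sum_commSize_mul_le_nBarMax hz _ k) hα0.le)
    (by omega)
  refine (measureReal_mono fun ω hω => ?_).trans
    (hmain.trans (natCast_mul_exp_neg_le (by omega) hq1))
  -- The diagonal of `P` is constantly `α` and that of `A` vanishes, so the diagonal part is `-α I`.
  -- Its norm is at most `√d`, which accounts for the `+ 1` in the constant.
  have hdecomp : A ω - probMatrix z (α • baseConn K τ) =
      (Matrix.of fun a b => if a = b then 0 else A ω a b - (α • baseConn K τ) (z a) (z b)) +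
        -(α • (1 : Matrix (Fin n) (Fin n) ℝ)) := by
    ext a b
    by_cases h : a = b
    · subst h
      simp [probMatrix_apply, hA.diag_zero, baseConn_apply]
    · simp [probMatrix_apply, h]
  have hω' : _ < specNorm (A ω - probMatrix z (α • baseConn K τ)) := hω
  rw [hdecomp] at hω'
  have h1 := hω'.trans_le (specNorm_add_le _ _)
  rw [specNorm_neg] at h1
  have h2 := specNorm_smul_one_le (n := n) hα0.le
  have h3 : α ≤ √d := by
    refine Real.le_sqrt_of_sq_le ?_
    nlinarith
  have h4 : √(40000 * Real.exp 129 * (2 ^ j : ℕ)) ≤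
      √(40000 * Real.exp 129 * (2 * (1 + (ν + 1) / c + 2 / (c * Real.log 2)))) * √d := by
    rw [← Real.sqrt_mul (by positivity)]
    refine Real.sqrt_le_sqrt ?_
    rw [mul_assoc (40000 * Real.exp 129)]
    gcongr
  change √(40000 * Real.exp 129 * (2 ^ j : ℕ)) < _
  linarith

end BlockBound

end StochasticBlock

/-! ### The main theorem -/

theorem proposition1 (c : ℝ) (hc : 0 < c) (ν : ℝ) (hν : 0 < ν) :
    ∃ C : ℝ, 0 < C ∧
      ∀ (n K nmin nmax : ℕ) (τ α : ℝ) (z : Fin n → Fin K)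
        (Ω : Type*) [MeasurableSpace Ω] (μ : Measure Ω) [IsProbabilityMeasure μ]
        (A : Ω → Matrix (Fin n) (Fin n) ℝ),
        0 ≤ τ → τ ≤ 1 → 0 < α → α < 1 →
        0 < nmin →
        (∀ k, nmin ≤ StochasticBlock.commSize z k ∧ StochasticBlock.commSize z k ≤ nmax) →
        StochasticBlock.IsSBM μ z (α • StochasticBlock.baseConn K τ) A →
        c * (Real.log n / StochasticBlock.nBarMin n nmin nmax (StochasticBlock.baseConn K τ)) ≤ α →
        1 - ∑ k, (StochasticBlock.commSize z k : ℝ) ^ (-ν) ≤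
          μ.real {ω |
            StochasticBlock.specNorm
                (A ω - StochasticBlock.probMatrix z (α • StochasticBlock.baseConn K τ)) ≤
              C * √(StochasticBlock.nBarMax n nmin nmax (StochasticBlock.baseConn K τ) * α)} := by
  refine ⟨√(40000 * Real.exp 129 * (2 * (1 + (ν + 1) / c + 2 / (c * Real.log 2)))) + 1,
    by positivity, ?_⟩
  intro n K nmin nmax τ α z Ω _ μ _ A hτ0 hτ1 hα0 hα1 hmin hz hA hα
  rcases Nat.eq_zero_or_pos n with rfl | hn0
  · have huniv : ∀ ω, StochasticBlock.specNorm
        (A ω - StochasticBlock.probMatrix z (α • StochasticBlock.baseConn K τ)) = 0 := fun ω => by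
      rw [StochasticBlock.specNorm, Subsingleton.elim (A ω - _) 0, map_zero, norm_zero]
    have hset : {ω | StochasticBlock.specNorm
        (A ω - StochasticBlock.probMatrix z (α • StochasticBlock.baseConn K τ)) ≤
        (√(40000 * Real.exp 129 * (2 * (1 + (ν + 1) / c + 2 / (c * Real.log 2)))) + 1) *
          √(StochasticBlock.nBarMax 0 nmin nmax (StochasticBlock.baseConn K τ) * α)} =
        Set.univ := by
      refine Set.eq_univ_of_forall fun ω => ?_
      rw [Set.mem_ofPred_eq, huniv ω]
      positivity
    rw [hset, probReal_univ, sub_le_self_iff]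
    exact Finset.sum_nonneg fun k _ => Real.rpow_nonneg (Nat.cast_nonneg _) _
  have hsum := StochasticBlock.rpow_neg_le_sum_commSize_rpow_neg hn0 z hν
  rcases Nat.lt_or_ge n 2 with hn1 | hn2
  -- For a single node the subtracted sum is at least 1, so the claimed probability is nonpositive.
  · obtain rfl : n = 1 := by omega
    rw [Nat.cast_one, Real.one_rpow] at hsum
    exact (sub_nonpos.2 hsum).trans measureReal_nonneg
  · have h := hA.measureReal_specNorm_sub_gt_le hc hν hn2 hτ0 hτ1 hα0 hα1 hmin hz hα
    have hcompl := StochasticBlock.one_le_measureReal_add_compl μ {ω | StochasticBlock.specNorm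
      (A ω - StochasticBlock.probMatrix z (α • StochasticBlock.baseConn K τ)) ≤
        (√(40000 * Real.exp 129 * (2 * (1 + (ν + 1) / c + 2 / (c * Real.log 2)))) + 1) *
          √(StochasticBlock.nBarMax n nmin nmax (StochasticBlock.baseConn K τ) * α)}
    simp only [Set.compl_ofPred, not_le] at hcompl
    linarith
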